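/- Let $R$ be an associative ring with $1$ and $M$ a (unital) right $R$-module. Write elements of $M^n$ as row vectors and elements of $R^n$ as column vectors, so that an $n\times n'$ matrix $A$ over $R$ induces an additive group homomorphism $M^n\to M^{n'}$, $a\mapsto aA$, with kernel $\mathrm{ann}_{M^n}(A)$; call a square matrix $M$-invertible if the map it induces is bijective. For $n\ge 1$ consider the conditions $(\mathrm{E}_n)$ For every $n\times(n-1)$ matrix $X$ over $R$ whose top $(n-1)\times(n-1)$ block is $M$-invertible, and every column vector $y\in R^n$, the map $a\mapsto ay$ either annihilates $K=\ker(X\colon M^n\to M^{n-1})$ or maps $K$ bijectively onto $M$. $(\mathrm{X}_n)$ There do not exist an $n\times(n-1)$ matrix $A$ over $R$ and $n\times n$ matrices $B,C$ over $R$, each obtained by adding a single column to $A$, such that $\mathrm{ann}_{M^n}(A)\supsetneq\mathrm{ann}_{M^n}(B)\supsetneq\mathrm{ann}_{M^n}(C)$. (For $n=0$, $(\mathrm{X}_n)$ holds trivially.) Let $N\ge 0$. If $(\mathrm{E}_n)$ holds for all $0<n\le N$, then $(\mathrm{X}_n)$ holds for all $n\le N$. Hence, if $(\mathrm{E}_n)$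 holds for all $n>0$ and $M$ is nonzero and faithful, then $R$ admits an embedding (an injective unital ring homomorphism) into a division ring. -/

import Mathlib

universe u v

/-!
Right modules over a (not necessarily commutative) ring `R` are modules over `Rᵐᵒᵖ`:
the right action `a · r` is `MulOpposite.op r • a`.
Elements of `M ^ m` are regarded as row vectors, elements of `R ^ m` as column vectors.
-/

section RightModule

variable {R : Type*} [Ring R] (M : Type*) [AddCommGroup M] [Module Rᵐᵒᵖ M]

/-- The action of a column vector `y` over `R` on row vectors over the right module `M`:
`a ↦ a y = ∑ i, a i · y i`. -/
def colAct {m : Type*} [Fintype m] (y : m → R) : (m → M) →+ M where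
  toFun a := ∑ i, MulOpposite.op (y i) • a i
  map_zero' := by simp
  map_add' a b := by simp [Finset.sum_add_distrib]

/-- The additive group homomorphism `M ^ m → M ^ n`, `a ↦ a A`, induced by an `m × n` matrix `A`
over `R`; the `j`-th entry of `a A` is the result of applying the `j`-th column of `A` to `a`. -/
def matAct {m n : Type*} [Fintype m] (A : Matrix m n R) : (m → M) →+ (n → M) where
  toFun a j := colAct M (fun i => A i j) a
  map_zero' := by ext; simp
  map_add' a b := by ext; simp

/-- `ann_{M ^ m}(A)`: the additive subgroup of `M ^ m` annihilated by the matrix `A`. -/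
def annMat {m n : Type*} [Fintype m] (A : Matrix m n R) : AddSubgroup (m → M) :=
  (matAct M A).ker

/-- A square matrix over `R` is `M`-invertible if it induces an invertible map `M ^ n → M ^ n`. -/
def MInvertible {n : Type*} [Fintype n] (A : Matrix n n R) : Prop :=
  Function.Bijective (matAct M A)

variable (R)

/-- The either/or condition in size `n` (meant for `0 < n`): for every `n × (n - 1)` matrix `X`
over `R` whose top `(n - 1) × (n - 1)` block is `M`-invertible, and every column `y ∈ R ^ n`,
the action of `y` either annihilates the kernel of `M ^ n → M ^ (n - 1)` induced by `X`,
or maps that kernel bijectively onto `M`. -/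
def EitherOr (n : ℕ) : Prop :=
  ∀ (X : Matrix (Fin n) (Fin (n - 1)) R) (y : Fin n → R),
    MInvertible M (X.submatrix (Fin.castLE (Nat.sub_le n 1)) id) →
      (∀ a ∈ (matAct M X).ker, colAct M y a = 0) ∨
        Set.BijOn (colAct M y) (matAct M X).ker Set.univ

variable {R}

/-- For `0 < n`: the `n × n` matrix `B` is obtained by adding a single column
(in some position) to the `n × (n - 1)` matrix `A`, i.e., the columns of `A`, in order, are all
but one of the columns of `B`. -/
def AddsColumn {n : ℕ} (A : Matrix (Fin n) (Fin (n - 1)) R) (B : Matrix (Fin n) (Fin n) R) : Prop :=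
  ∃ e : Fin (n - 1) ↪o Fin n, B.submatrix id e = A

variable (R)

/-- The exchange-type annihilator condition in size `n`: there do not exist an `n × (n - 1)`
matrix `A` and `n × n` matrices `B`, `C`, each obtained by adding a single column to `A`, with
`ann(A) ⊋ ann(B) ⊋ ann(C)` in `M ^ n`. -/
def ExchangeAnn (n : ℕ) : Prop :=
  ¬ ∃ (A : Matrix (Fin n) (Fin (n - 1)) R) (B C : Matrix (Fin n) (Fin n) R),
      AddsColumn A B ∧ AddsColumn A C ∧ annMat M B < annMat M A ∧ annMat M C < annMat M B

end RightModule

section RightModule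

open MulOpposite

variable {R : Type*} [Ring R] {M : Type*} [AddCommGroup M] [Module Rᵐᵒᵖ M]

/-! ### Basic properties of the actions of columns and matrices -/

/-! Border an `M`-invertible `P` by a row `x`, a column `y` and a corner `t`. The kernel of `P`
stacked on `x` is parametrized by its last coordinate `s`, and there the column `(y, t)` acts as the
Schur complement `s ↦ s t - (s x) P⁻¹ y`. The either/or condition thus says that every Schur
complement is zero or bijective (`EitherOr.eq_zero_or_bijective`).

For the exchange condition, take `P` to be a maximal `M`-invertible submatrix of `A`. Maximality
makes the Schur complements from the columns of `A` vanish, so the projection attached to `P` has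
image `ann(A)`. On each coordinate of this image an added column acts by zero or bijectively. A
coordinate where `b` is nonzero is one where `c` is too, and this forces `ann(B) ≤ ann(C)`.

For the embedding, the endomorphisms `v P⁻¹ u` form a subring of `End M` closed under existing
inverses. Each is a Schur complement, hence zero or invertible, so the subring is a division ring;
faithfulness embeds `Rᵐᵒᵖ` in it. -/

theorem colAct_apply {m : Type*} [Fintype m] (y : m → R) (a : m → M) :
    colAct M y a = ∑ i, op (y i) • a i := rfl

theorem matAct_apply {m n : Type*} [Fintype m] (A : Matrix m n R) (a : m → M) (j : n) :
    matAct M A a j = colAct M (fun i => A i j) a := rfl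

theorem mem_annMat_iff {m n : Type*} [Fintype m] (A : Matrix m n R) (a : m → M) :
    a ∈ annMat M A ↔ ∀ j, colAct M (fun i => A i j) a = 0 :=
  funext_iff

theorem colAct_comp_equiv {m m' : Type*} [Fintype m] [Fintype m'] (σ : m ≃ m') (y : m' → R)
    (a : m' → M) : colAct M (y ∘ σ) (a ∘ σ) = colAct M y a :=
  σ.sum_comp fun i => op (y i) • a i

theorem colAct_sumElim {m m' : Type*} [Fintype m] [Fintype m'] (y : m → R) (y' : m' → R)
    (a : m ⊕ m' → M) :
    colAct M (Sum.elim y y') a = colAct M y (a ∘ Sum.inl) + colAct M y' (a ∘ Sum.inr) := by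
  simp [colAct_apply]

theorem matAct_submatrix_equiv {m m' n n' : Type*} [Fintype m] [Fintype m'] (A : Matrix m' n' R)
    (σ : m ≃ m') (τ : n → n') (a : m' → M) :
    matAct M (A.submatrix σ τ) (a ∘ σ) = matAct M A a ∘ τ :=
  funext fun j => colAct_comp_equiv σ (fun i => A i (τ j)) a

theorem MInvertible.submatrix_equiv {m m' : Type*} [Fintype m] [Fintype m'] {A : Matrix m' m' R}
    (hA : MInvertible M A) (σ τ : m ≃ m') : MInvertible M (A.submatrix σ τ) := by
  have h : matAct M (A.submatrix σ τ) =
      (τ.symm.arrowCongr (Equiv.refl M)) ∘ matAct M A ∘ (σ.arrowCongr (Equiv.refl M)) := by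
    funext a
    have := matAct_submatrix_equiv A σ τ (a ∘ σ.symm)
    rw [Function.comp_assoc, σ.symm_comp_self] at this
    exact this
  unfold MInvertible
  rw [h]
  exact (Equiv.bijective _).comp (Function.Bijective.comp hA (Equiv.bijective _))

theorem matAct_fromBlocks {m m' n n' : Type*} [Fintype m] [Fintype m'] (A : Matrix m n R)
    (B : Matrix m n' R) (C : Matrix m' n R) (D : Matrix m' n' R) (a : m → M) (b : m' → M) :
    matAct M (Matrix.fromBlocks A B C D) (Sum.elim a b) =
      Sum.elim (matAct M A a + matAct M C b) (matAct M B a + matAct M D b) := by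
  funext j
  cases j <;> simp [matAct_apply, colAct_apply]

/-- A block matrix with `M`-invertible upper left block is `M`-invertible if its Schur complement
is bijective. -/
theorem MInvertible.fromBlocks {m n : Type*} [Fintype m] [Fintype n] {A : Matrix m m R}
    (hA : MInvertible M A) {B : Matrix m n R} {C : Matrix n m R} {D : Matrix n n R}
    (S : (n → M) →+ (n → M)) (hS : Function.Bijective S)
    (h : ∀ a b, matAct M A a + matAct M C b = 0 → S b = matAct M B a + matAct M D b) :
    MInvertible M (Matrix.fromBlocks A B C D) := by
  constructor
  · rw [injective_iff_map_eq_zero]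
    intro w hw
    obtain ⟨a, b, rfl⟩ : ∃ a b, w = Sum.elim a b :=
      ⟨_, _, (Sum.elim_comp_inl_inr w).symm⟩
    rw [matAct_fromBlocks] at hw
    have h1 : matAct M A a + matAct M C b = 0 := congrArg (· ∘ Sum.inl) hw
    have h2 : matAct M B a + matAct M D b = 0 := congrArg (· ∘ Sum.inr) hw
    have hb : b = 0 := (injective_iff_map_eq_zero S).1 hS.1 b ((h a b h1).trans h2)
    subst hb
    have ha : a = 0 := (injective_iff_map_eq_zero _).1 hA.1 a (by simpa using h1)
    subst ha
    exact Sum.elim_zero_zero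
  · intro w
    obtain ⟨x, y, rfl⟩ : ∃ a b, w = Sum.elim a b :=
      ⟨_, _, (Sum.elim_comp_inl_inr w).symm⟩
    obtain ⟨a₀, rfl⟩ := hA.2 x
    -- Block elimination: `a₀` hits `x`, `b` corrects the second component, and `a₁` cancels the
    -- effect of `b` on the first.
    obtain ⟨b, hb⟩ := hS.2 (y - matAct M B a₀)
    obtain ⟨a₁, ha₁⟩ := hA.2 (-matAct M C b)
    have h1 := h a₁ b (by rw [ha₁]; abel)
    refine ⟨Sum.elim (a₀ + a₁) b, ?_⟩
    rw [matAct_fromBlocks, map_add, map_add, ha₁, add_assoc (matAct M B a₀), ← h1, hb]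
    congr 1 <;> abel

/-- The either/or condition for matrices with an arbitrary finite index set, expressed by means of
the endomorphism of `M` that the column `(y, t)` induces on the kernel of the matrix with upper
block `A` and last row `x`. -/
theorem EitherOr.eq_zero_or_bijective {m : Type*} [Fintype m]
    (hE : EitherOr R M (Fintype.card m + 1)) {A : Matrix m m R} (hA : MInvertible M A)
    (x y : m → R) (t : R) (e : M →+ M)
    (he : ∀ a s, matAct M A a + (fun j => op (x j) • s) = 0 → e s = colAct M y a + op t • s) :
    e = 0 ∨ Function.Bijective e := by
  set k := Fintype.card m
  let σ : Fin k ≃ m := (Fintype.equivFin m).symm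
  let X : Matrix (Fin (k + 1)) (Fin k) R := Fin.snoc (fun i j => A (σ i) (σ j)) (fun j => x (σ j))
  let z : Fin (k + 1) → R := Fin.snoc (fun i => y (σ i)) t
  have hz : ∀ w : Fin (k + 1) → M, colAct M z w =
      colAct M y (fun i => w (σ.symm i).castSucc) + op t • w (Fin.last k) := by
    intro w
    rw [colAct_apply, Fin.sum_univ_castSucc, ← colAct_comp_equiv σ]
    simp [z, colAct_apply]
  have hX : ∀ w : Fin (k + 1) → M, matAct M X w = 0 ↔
      matAct M A (fun i => w (σ.symm i).castSucc) +
        (fun j => op (x j) • w (Fin.last k)) = 0 := by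
    intro w
    rw [funext_iff, funext_iff, ← σ.forall_congr_right]
    refine forall_congr' fun j => ?_
    rw [matAct_apply, Pi.add_apply, matAct_apply, colAct_apply, Fin.sum_univ_castSucc,
      ← colAct_comp_equiv σ]
    simp [X, colAct_apply]
  -- Invertibility of the top block lets any last coordinate be completed to a kernel element.
  have hker : ∀ s : M, ∃ w : Fin (k + 1) → M, matAct M X w = 0 ∧ w (Fin.last k) = s := by
    intro s
    obtain ⟨a, ha⟩ := hA.2 (-fun j => op (x j) • s)
    refine ⟨Fin.snoc (fun i => a (σ i)) s, ?_, by simp⟩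
    rw [hX]
    simp [ha]
  have hval : ∀ w : Fin (k + 1) → M, matAct M X w = 0 → colAct M z w = e (w (Fin.last k)) := by
    intro w hw
    rw [hz, he _ _ ((hX w).1 hw)]
  have htop : MInvertible M (X.submatrix (Fin.castLE (Nat.sub_le (k + 1) 1)) id) := by
    have hXA : (X.submatrix Fin.castSucc id : Matrix (Fin k) (Fin k) R) = A.submatrix σ σ := by
      ext i j
      rw [Matrix.submatrix_apply]
      simp [X]
    have h := hA.submatrix_equiv σ σ
    rw [← hXA] at h
    exact h
  refine (hE X z htop).imp (fun h => ?_) fun h => ⟨?_, ?_⟩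
  · ext s
    obtain ⟨w, hw, rfl⟩ := hker s
    rw [← hval w hw]
    exact h w hw
  · rw [injective_iff_map_eq_zero]
    intro s hs
    obtain ⟨w, hw, rfl⟩ := hker s
    rw [← hval w hw] at hs
    have : w = 0 := h.injOn hw (zero_mem _) (hs.trans (map_zero _).symm)
    rw [this, Pi.zero_apply]
  · intro s
    obtain ⟨w, hw, rfl⟩ := h.surjOn (Set.mem_univ s)
    exact ⟨_, (hval w hw).symm⟩

/-! ### The exchange condition -/

/-- Adding a column `b` to `A` cuts the annihilator down to those rows that kill `b`. -/
theorem AddsColumn.exists_column {n : ℕ} {A : Matrix (Fin (n + 1)) (Fin n) R}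
    {B : Matrix (Fin (n + 1)) (Fin (n + 1)) R} (h : AddsColumn (n := n + 1) A B) :
    ∃ b : Fin (n + 1) → R, ∀ w : Fin (n + 1) → M,
      w ∈ annMat M B ↔ w ∈ annMat M A ∧ colAct M b w = 0 := by
  obtain ⟨e, rfl⟩ := h
  change Fin n ↪o Fin (n + 1) at e
  -- The embedding misses exactly one index, the position of the new column.
  obtain ⟨p, hp⟩ : ∃ p, (Finset.univ.map e.toEmbedding)ᶜ = {p} := by
    rw [← Finset.card_eq_one, Finset.card_compl]
    simp
  refine ⟨fun i => B i p, fun w => ?_⟩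
  rw [mem_annMat_iff, mem_annMat_iff]
  refine ⟨fun h => ⟨fun j => h (e j), h p⟩, fun h j => ?_⟩
  by_cases hj : j ∈ Finset.univ.map e.toEmbedding
  · obtain ⟨i, -, rfl⟩ := Finset.mem_map.1 hj
    exact h.1 i
  · rw [← Finset.mem_compl, hp, Finset.mem_singleton] at hj
    exact hj ▸ h.2

/-- Among the `M`-invertible submatrices of a matrix there is one of maximal size. -/
theorem exists_maximal_MInvertible_submatrix {p q : ℕ} (A : Matrix (Fin p) (Fin q) R) :
    ∃ (m : Type) (_ : Fintype m) (r : m ↪ Fin p) (c : m ↪ Fin q), MInvertible M (A.submatrix r c) ∧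
      ∀ (m' : Type) [Fintype m'] (r' : m' ↪ Fin p) (c' : m' ↪ Fin q),
        MInvertible M (A.submatrix r' c') → Fintype.card m' ≤ Fintype.card m := by
  classical
  let P : ℕ → Prop := fun k => ∃ (m : Type) (_ : Fintype m) (r : m ↪ Fin p) (c : m ↪ Fin q),
    MInvertible M (A.submatrix r c) ∧ Fintype.card m = k
  -- The empty matrix is `M`-invertible, so the search never fails.
  have hP0 : P 0 := ⟨Empty, inferInstance, Function.Embedding.ofIsEmpty,
    Function.Embedding.ofIsEmpty, ⟨Function.injective_of_subsingleton _,
      fun w => ⟨w, Subsingleton.elim _ _⟩⟩, rfl⟩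
  obtain ⟨m, hm, r, c, h, hcard⟩ := Nat.findGreatest_spec (P := P) (Nat.zero_le p) hP0
  refine ⟨m, hm, r, c, h, fun m' _ r' c' h' => ?_⟩
  rw [hcard]
  refine Nat.le_findGreatest ?_ ⟨m', _, r', c', h', rfl⟩
  simpa using Fintype.card_le_of_injective r' r'.injective

/-- Extension of a row vector by zero along an injection. -/
noncomputable def extendRow {m n : Type*} (r : m ↪ n) : (m → M) →+ (n → M) where
  toFun a := Function.extend r a 0
  map_zero' := by
    funext i
    by_cases h : ∃ j, r j = i
    · obtain ⟨j, rfl⟩ := h; simp [r.injective.extend_apply]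
    · simp [Function.extend_apply' _ _ _ h]
  map_add' a b := by
    funext i
    by_cases h : ∃ j, r j = i
    · obtain ⟨j, rfl⟩ := h; simp [r.injective.extend_apply]
    · simp [Function.extend_apply' _ _ _ h]

theorem colAct_extendRow {m n : Type*} [Fintype m] [Fintype n] (r : m ↪ n) (y : n → R)
    (a : m → M) : colAct M y (extendRow r a) = colAct M (y ∘ r) a := by
  classical
  rw [colAct_apply, colAct_apply]
  refine (Finset.sum_of_injOn r r.injective.injOn (by simp) ?_ ?_).symm
  · intro i _ hi
    have : ¬ ∃ j, r j = i := by simpa using hi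
    simp [extendRow, Function.extend_apply' _ _ _ this]
  · intro i _
    simp [extendRow, r.injective.extend_apply]

theorem colAct_single {n : Type*} [Fintype n] [DecidableEq n] (y : n → R) (i : n) (s : M) :
    colAct M y (Pi.single i s) = op (y i) • s := by
  rw [colAct_apply, Finset.sum_eq_single i]
  · simp
  · intro j _ hj; simp [hj]
  · simp

/-- Given an `M`-invertible submatrix of `A` with rows `r` and columns `c`, there is a projection
`φ` of `M ^ p` to the annihilator of the columns `c` of `A` that changes
only the entries with index in `r`. -/
theorem exists_projection {p q m : Type*} [Fintype p] [Fintype m] {A : Matrix p q R}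
    {r : m ↪ p} {c : m ↪ q} (h : MInvertible M (A.submatrix r c)) :
    ∃ (φ : (p → M) →+ (p → M)) (α : (p → M) →+ (m → M)),
      (∀ w, φ w = w - extendRow r (α w)) ∧
      (∀ w, matAct M (A.submatrix r c) (α w) = fun j => colAct M (fun i => A i (c j)) w) ∧
      (∀ w j, colAct M (fun i => A i (c j)) (φ w) = 0) ∧
      (∀ w, (∀ j, colAct M (fun i => A i (c j)) w = 0) → φ w = w) ∧
      ∀ a, φ (extendRow r a) = 0 := by
  let P := AddEquiv.ofBijective (matAct M (A.submatrix r c)) h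
  -- `α w` is the correction on the rows `r` that has the same image as `w` under the columns `c`.
  let α : (p → M) →+ (m → M) := P.symm.toAddMonoidHom.comp (matAct M (A.submatrix id c))
  have hα : ∀ w, matAct M (A.submatrix r c) (α w) = fun j => colAct M (fun i => A i (c j)) w :=
    fun w => P.apply_symm_apply _
  have hcol : ∀ a j, colAct M (fun i => A i (c j)) (extendRow r a) =
      matAct M (A.submatrix r c) a j := fun a j => colAct_extendRow r _ a
  refine ⟨AddMonoidHom.id _ - (extendRow r).comp α, α, fun w => rfl, hα, fun w j => ?_,
    fun w hw => ?_, fun a => ?_⟩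
  · change colAct M _ (w - extendRow r (α w)) = 0
    rw [map_sub, hcol, hα, sub_self]
  · have : α w = 0 := h.1 (by rw [hα, map_zero]; exact funext hw)
    change w - extendRow r (α w) = w
    rw [this, map_zero, sub_zero]
  · have : α (extendRow r a) = a := h.1 (by rw [hα]; exact funext fun j => hcol a j)
    change extendRow r a - extendRow r (α (extendRow r a)) = 0
    rw [this, sub_self]

/-- The annihilator condition of the exchange type follows from the either/or condition. -/
theorem exchangeAnn_of_eitherOr {n : ℕ} (hE : ∀ k, 0 < k → k ≤ n → EitherOr R M k) :
    ExchangeAnn R M n := by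
  classical
  rintro ⟨A, B, C, hB, hC, hBA, hCB⟩
  rcases n with - | n
  · exact hBA.ne (Subsingleton.elim _ _)
  change Matrix (Fin (n + 1)) (Fin n) R at A
  obtain ⟨b, hb⟩ := hB.exists_column (M := M)
  obtain ⟨c, hc⟩ := hC.exists_column (M := M)
  have : Nontrivial M := by
    by_contra hM
    rw [not_nontrivial_iff_subsingleton] at hM
    exact hBA.ne (Subsingleton.elim _ _)
  obtain ⟨m, _, r, κ, hP, hmax⟩ := exists_maximal_MInvertible_submatrix (M := M) A
  obtain ⟨φ, α, hφ, hα, hφker, hφid, hφr⟩ := exists_projection hP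
  have hcard : Fintype.card m ≤ n := by
    simpa using Fintype.card_le_of_injective κ κ.injective
  -- `g z i` is the Schur complement of the maximal block bordered by row `i` of `A` and the column
  -- `z`.
  let g : (Fin (n + 1) → R) → Fin (n + 1) → M →+ M := fun z i =>
    (colAct M z).comp (φ.comp (AddMonoidHom.single (fun _ => M) i))
  have hg : ∀ z i s, g z i s = op (z i) • s - colAct M (z ∘ r) (α (Pi.single i s)) := by
    intro z i s
    change colAct M z (φ (Pi.single i s)) = _
    rw [hφ, map_sub, colAct_single, colAct_extendRow]
  have hα' : ∀ i s, matAct M (A.submatrix r κ) (α (Pi.single i s)) =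
      fun j => op (A i (κ j)) • s := by
    intro i s
    rw [hα]
    exact funext fun j => colAct_single _ i s
  have hgsum : ∀ z w, colAct M z (φ w) = ∑ i, g z i (w i) := by
    intro z w
    conv_lhs => rw [← Finset.univ_sum_single w, map_sum, map_sum]
    rfl
  have hgr : ∀ z j, g z (r j) = 0 := by
    intro z j
    ext s
    have : Pi.single (r j) s = extendRow r (Pi.single j s) := by
      funext i
      by_cases h : ∃ j', r j' = i
      · obtain ⟨j', rfl⟩ := h
        simp [extendRow, r.injective.extend_apply, Pi.single_apply]
      · have hi : i ≠ r j := fun h' => h ⟨j, h'.symm⟩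
        simp [extendRow, Function.extend_apply' _ _ _ h, hi]
    change colAct M z (φ (Pi.single (r j) s)) = 0
    rw [this, hφr, map_zero]
  have hgE : ∀ z i, g z i = 0 ∨ Function.Bijective (g z i) := by
    intro z i
    refine (hE _ (Nat.succ_pos _) (Nat.succ_le_succ hcard)).eq_zero_or_bijective hP
      (fun j => A i (κ j)) (z ∘ r) (z i) (g z i) fun a s h => ?_
    have ha : a = -α (Pi.single i s) := hP.1 (by
      rw [map_neg, hα', eq_neg_iff_add_eq_zero]
      exact h)
    rw [hg, ha, map_neg]
    abel
  -- A bijective Schur complement would make the block enlarged by row `i` and column `j`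
  -- `M`-invertible, against maximality.
  have hgA : ∀ j i, g (fun i => A i j) i = 0 := by
    intro j i
    by_cases hj : j ∈ Set.range κ
    · obtain ⟨j, rfl⟩ := hj
      ext s
      exact hφker _ j
    refine (hgE _ i).resolve_right fun hbij => ?_
    have hi : i ∉ Set.range r := by
      rintro ⟨i, rfl⟩
      rw [hgr] at hbij
      obtain ⟨s, hs⟩ := exists_ne (0 : M)
      exact hs (hbij.1 rfl)
    let r' : m ⊕ Unit ↪ Fin (n + 1) := ⟨Sum.elim r fun _ => i,
      r.injective.sumElim (Function.injective_of_subsingleton _) fun a _ h => hi ⟨a, h⟩⟩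
    let κ' : m ⊕ Unit ↪ Fin n := ⟨Sum.elim κ fun _ => j,
      κ.injective.sumElim (Function.injective_of_subsingleton _) fun a _ h => hj ⟨a, h⟩⟩
    have hinv : MInvertible M (A.submatrix r' κ') := by
      rw [← Matrix.fromBlocks_toBlocks (A.submatrix r' κ')]
      let U := Equiv.funUnique Unit M
      let S : (Unit → M) →+ (Unit → M) :=
        { toFun := fun f _ => g (fun i => A i j) i (f ())
          map_zero' := by funext _; simp
          map_add' := fun f f' => by funext _; simp }
      refine MInvertible.fromBlocks (A := A.submatrix r κ) hP S
        (U.symm.bijective.comp (hbij.comp U.bijective)) fun a f h => ?_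
      have ha : a = -α (Pi.single i (f ())) := hP.1 (by
        rw [map_neg, hα', eq_neg_iff_add_eq_zero, ← h]
        congr 1
        funext j
        simp [matAct_apply, colAct_apply, Matrix.toBlocks₂₁, r', κ'])
      funext _
      change g (fun i => A i j) i (f ()) = _
      rw [hg, ha, map_neg, sub_eq_neg_add, Pi.add_apply, Pi.neg_apply]
      simp [matAct_apply, colAct_apply, Matrix.toBlocks₁₂, Matrix.toBlocks₂₂, r', κ']
    have := hmax _ r' κ' hinv
    simp at this
  have hφA : ∀ w, φ w ∈ annMat M A := fun w => (mem_annMat_iff _ _).2 fun j => by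
    rw [hgsum]
    exact Finset.sum_eq_zero fun i _ => by rw [hgA]; rfl
  have hAφ : ∀ w ∈ annMat M A, φ w = w := fun w hw =>
    hφid w fun j => (mem_annMat_iff _ _).1 hw (κ j)
  obtain ⟨l, hl⟩ : ∃ l, g b l ≠ 0 := by
    by_contra! h
    refine hBA.not_ge fun w hw => (hb w).2 ⟨hw, ?_⟩
    rw [← hAφ w hw, hgsum]
    exact Finset.sum_eq_zero fun i _ => by rw [h]; rfl
  have hbl := (hgE b l).resolve_left hl
  have hcb : ∀ w ∈ annMat M A, colAct M c w = 0 → colAct M b w = 0 := fun w hw h =>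
    ((hb w).1 (hCB.le ((hc w).2 ⟨hw, h⟩))).2
  have hcl : Function.Bijective (g c l) := by
    refine (hgE c l).resolve_left fun h => hl ?_
    ext s
    exact hcb _ (hφA (Pi.single l s)) (DFunLike.congr_fun h s)
  refine hCB.not_ge fun w hw => ?_
  obtain ⟨hwA, hwb⟩ := (hb w).1 hw
  refine (hc w).2 ⟨hwA, ?_⟩
  -- Subtracting `φ (Pi.single l s)` from `w` gives an element of `ann(A)` killed by `c`, hence by
  -- `b`. As `b` kills `w`, this yields `g b l s = 0` and so `s = 0`.
  obtain ⟨s, hs⟩ := hcl.2 (colAct M c w)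
  have hs' : colAct M c (φ (Pi.single l s)) = colAct M c w := hs
  have h := hcb _ (sub_mem hwA (hφA (Pi.single l s))) (by rw [map_sub, hs', sub_self])
  rw [map_sub, hwb, zero_sub, neg_eq_zero] at h
  have hs0 : s = 0 := (injective_iff_map_eq_zero _).1 hbl.1 s h
  rw [← hs, hs0, map_zero]

/-! ### The rational closure -/

/-- The endomorphism `e` of `M` is an entry of a rational expression `v A⁻¹ u` over `R`, where `A`
is an `M`-invertible matrix, `v` a row and `u` a column. -/
def IsRationalVia {m : Type*} [Fintype m] (A : Matrix m m R) (v u : m → R)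
    (e : AddMonoid.End M) : Prop :=
  ∀ a s, (matAct M A a = fun j => op (v j) • s) → e s = colAct M u a

theorem IsRationalVia.ext {m : Type*} [Fintype m] {A : Matrix m m R} (hA : MInvertible M A)
    {v u : m → R} {e e' : AddMonoid.End M} (h : IsRationalVia A v u e)
    (h' : IsRationalVia A v u e') : e = e' := by
  ext s
  obtain ⟨a, ha⟩ := hA.2 fun j => op (v j) • s
  rw [h a s ha, h' a s ha]

variable (R M) in
/-- The set of endomorphisms of `M` given by rational expressions over `R`. -/
def rationalSet : Set (AddMonoid.End M) :=
  {e | ∃ (m : Type) (_ : Fintype m) (A : Matrix m m R) (v u : m → R),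
    MInvertible M A ∧ IsRationalVia A v u e}

theorem matAct_one {m : Type*} [Fintype m] [DecidableEq m] (a : m → M) :
    matAct M (1 : Matrix m m R) a = a := by
  funext j
  rw [matAct_apply, colAct_apply, Finset.sum_eq_single j]
  · simp
  · intro i _ hi; simp [Matrix.one_apply_ne hi]
  · simp

theorem matAct_zero {m n : Type*} [Fintype m] (a : m → M) :
    matAct M (0 : Matrix m n R) a = 0 := by
  funext j
  simp [matAct_apply, colAct_apply]

theorem toAddMonoidEnd_mem_rationalSet (t : Rᵐᵒᵖ) :
    Module.toAddMonoidEnd Rᵐᵒᵖ M t ∈ rationalSet R M := by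
  refine ⟨Unit, inferInstance, 1, fun _ => 1, fun _ => unop t,
    ⟨fun a b h => by simpa [matAct_one] using h, fun a => ⟨a, matAct_one a⟩⟩, fun a s h => ?_⟩
  rw [matAct_one] at h
  change t • s = _
  simp [h, colAct_apply]

theorem neg_mem_rationalSet {e : AddMonoid.End M} (he : e ∈ rationalSet R M) :
    -e ∈ rationalSet R M := by
  obtain ⟨m, _, A, v, u, hA, h⟩ := he
  refine ⟨m, _, A, v, -u, hA, fun a s has => ?_⟩
  change -e s = _
  simp [h a s has, colAct_apply]

theorem add_mem_rationalSet {e e' : AddMonoid.End M} (he : e ∈ rationalSet R M)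
    (he' : e' ∈ rationalSet R M) : e + e' ∈ rationalSet R M := by
  obtain ⟨m, _, A, v, u, hA, h⟩ := he
  obtain ⟨m', _, A', v', u', hA', h'⟩ := he'
  refine ⟨m ⊕ m', inferInstance, Matrix.fromBlocks A 0 0 A', Sum.elim v v', Sum.elim u u',
    hA.fromBlocks (matAct M A') hA' (by simp [matAct_zero]), fun a s has => ?_⟩
  rw [← Sum.elim_comp_inl_inr a, matAct_fromBlocks] at has
  rw [matAct_zero, matAct_zero, add_zero, zero_add] at has
  have h1 : matAct M A (a ∘ Sum.inl) = fun j => op (v j) • s := congrArg (· ∘ Sum.inl) has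
  have h2 : matAct M A' (a ∘ Sum.inr) = fun j => op (v' j) • s := congrArg (· ∘ Sum.inr) has
  rw [colAct_sumElim, ← h _ s h1, ← h' _ s h2]
  rfl

/-- The off-diagonal block `-u v'` feeds the output `e s` of the first system into the second as its
input. -/
theorem mul_mem_rationalSet {e e' : AddMonoid.End M} (he' : e' ∈ rationalSet R M)
    (he : e ∈ rationalSet R M) : e' * e ∈ rationalSet R M := by
  obtain ⟨m, _, A, v, u, hA, h⟩ := he
  obtain ⟨m', _, A', v', u', hA', h'⟩ := he'
  have hB : ∀ a : m → M, matAct M (Matrix.of fun i j => -(u i * v' j)) a =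
      -fun j => op (v' j) • colAct M u a := by
    intro a
    funext j
    simp [matAct_apply, colAct_apply, Finset.smul_sum, mul_smul]
  refine ⟨m ⊕ m', inferInstance,
    Matrix.fromBlocks A (Matrix.of fun i j => -(u i * v' j)) 0 A', Sum.elim v 0, Sum.elim 0 u',
    hA.fromBlocks (matAct M A') hA' fun a b hab => ?_, fun a s has => ?_⟩
  · have : a = 0 := (injective_iff_map_eq_zero _).1 hA.1 a (by simpa [matAct_zero] using hab)
    rw [this, map_zero, zero_add]
  · rw [← Sum.elim_comp_inl_inr a, matAct_fromBlocks] at has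
    rw [matAct_zero, add_zero, hB] at has
    have h1 : matAct M A (a ∘ Sum.inl) = fun j => op (v j) • s := congrArg (· ∘ Sum.inl) has
    have h2 : -(fun j => op (v' j) • colAct M u (a ∘ Sum.inl)) + matAct M A' (a ∘ Sum.inr) =
        fun _ => op (0 : R) • s := congrArg (· ∘ Sum.inr) has
    have h2' : matAct M A' (a ∘ Sum.inr) = fun j => op (v' j) • e s := by
      rw [h _ s h1]
      rw [neg_add_eq_iff_eq_add] at h2
      simpa [funext_iff] using h2
    rw [colAct_sumElim, ← h' _ (e s) h2']
    simp [colAct_apply]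

/-- The matrix with blocks `A`, `u`, `-v`, `0` has Schur complement `e`. With right-hand side `(0,
s)` its last unknown `b` satisfies `e b = s`, and the column `(0, 1)` reads it off. -/
theorem inv_mem_rationalSet {e e' : AddMonoid.End M} (he : e ∈ rationalSet R M)
    (h1 : e * e' = 1) (h2 : e' * e = 1) : e' ∈ rationalSet R M := by
  obtain ⟨m, _, A, v, u, hA, h⟩ := he
  have h1' : ∀ s, e (e' s) = s := DFunLike.congr_fun h1
  have h2' : ∀ s, e' (e s) = s := DFunLike.congr_fun h2
  have hB : ∀ a : m → M, matAct M (Matrix.of fun i (_ : Unit) => u i) a =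
      fun _ => colAct M u a := fun a => rfl
  have hC : ∀ b : Unit → M, matAct M (Matrix.of fun (_ : Unit) j => -v j) b =
      -fun j => op (v j) • b () := by
    intro b
    funext j
    simp [matAct_apply, colAct_apply]
  let S : (Unit → M) →+ (Unit → M) :=
    { toFun := fun f _ => e (f ())
      map_zero' := by funext _; simp
      map_add' := fun f f' => by funext _; simp }
  refine ⟨m ⊕ Unit, inferInstance, Matrix.fromBlocks A (Matrix.of fun i _ => u i)
    (Matrix.of fun _ j => -v j) 0, Sum.elim 0 1, Sum.elim 0 1,
    hA.fromBlocks S ⟨fun f f' hf => ?_, fun f => ⟨fun _ => e' (f ()), ?_⟩⟩ fun a b hab => ?_,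
    fun a s has => ?_⟩
  · funext i
    have := congrArg e' (congrFun hf ())
    change e' (e (f ())) = e' (e (f' ())) at this
    rwa [h2', h2'] at this
  · funext i
    exact h1' _
  · rw [hC, add_neg_eq_zero] at hab
    rw [hB, matAct_zero, add_zero, ← h a _ hab]
    rfl
  · rw [← Sum.elim_comp_inl_inr a, matAct_fromBlocks] at has
    rw [hC, hB, matAct_zero, add_zero] at has
    have e1 : matAct M A (a ∘ Sum.inl) + -(fun j => op (v j) • a (Sum.inr ())) = 0 := by
      funext j
      simpa using congrFun has (Sum.inl j)
    have e2 : colAct M u (a ∘ Sum.inl) = s := by simpa using congrFun has (Sum.inr ())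
    have e1' := h _ _ (add_neg_eq_zero.1 e1)
    rw [e2] at e1'
    rw [colAct_sumElim, ← e1', h2']
    simp [colAct_apply]

variable (R M) in
/-- The rational closure of the image of `R` in the endomorphism ring of the abelian
group `M`. -/
def rationalClosure : Subring (AddMonoid.End M) where
  carrier := rationalSet R M
  mul_mem' := mul_mem_rationalSet
  one_mem' := by simpa using toAddMonoidEnd_mem_rationalSet (M := M) (1 : Rᵐᵒᵖ)
  add_mem' := add_mem_rationalSet
  zero_mem' := by simpa using toAddMonoidEnd_mem_rationalSet (M := M) (0 : Rᵐᵒᵖ)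
  neg_mem' := neg_mem_rationalSet

/-- `v A⁻¹ u` is the Schur complement for last row `-v`, column `u` and corner `0`. -/
theorem isUnit_or_eq_zero_of_eitherOr (hE : ∀ n, 0 < n → EitherOr R M n)
    (x : rationalClosure R M) : IsUnit x ∨ x = 0 := by
  obtain ⟨e, he⟩ := x
  obtain ⟨m, _, A, v, u, hA, h⟩ := id he
  have := (hE _ (Nat.succ_pos _)).eq_zero_or_bijective hA (-v) u 0 e fun a s has => by
    refine (h a s ?_).trans (by simp)
    rw [← add_neg_eq_zero, ← has]
    congr 1
    funext j
    simp
  refine this.symm.imp (fun hb => ?_) fun h0 => Subtype.ext h0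
  let E := AddEquiv.ofBijective e hb
  let e' : AddMonoid.End M := E.symm.toAddMonoidHom
  have h1 : e * e' = 1 := AddMonoidHom.ext fun s => E.apply_symm_apply s
  have h2 : e' * e = 1 := AddMonoidHom.ext fun s => E.symm_apply_apply s
  exact isUnit_iff_exists.2 ⟨⟨e', inv_mem_rationalSet he h1 h2⟩, Subtype.ext h1, Subtype.ext h2⟩

theorem IsRationalVia.submatrix_equiv {m m' : Type*} [Fintype m] [Fintype m'] {A : Matrix m' m' R}
    {v u : m' → R} {e : AddMonoid.End M} (h : IsRationalVia A v u e) (σ : m ≃ m') :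
    IsRationalVia (A.submatrix σ σ) (v ∘ σ) (u ∘ σ) e := by
  intro a s has
  have ha : a = (a ∘ σ.symm) ∘ σ := by rw [Function.comp_assoc, σ.symm_comp_self]; rfl
  rw [ha, matAct_submatrix_equiv] at has
  rw [ha, colAct_comp_equiv]
  refine h _ _ ?_
  funext j
  simpa using congrFun has (σ.symm j)

end RightModule

/-- The rational closure is no larger than `R`, up to countable cardinality. -/
instance small_rationalClosure {R : Type u} [Ring R] {M : Type v} [AddCommGroup M]
    [Module Rᵐᵒᵖ M] : Small.{u} (rationalClosure R M) := by
  classical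
  -- The data `(A, v, u)` lie in the universe of `R` and determine the endomorphism when `A` is
  -- `M`-invertible; data representing nothing go to `0`.
  let T := Σ n : ℕ, Matrix (Fin n) (Fin n) R × (Fin n → R) × (Fin n → R)
  let f : T → rationalClosure R M := fun t =>
    if h : ∃ e : rationalClosure R M, IsRationalVia t.2.1 t.2.2.1 t.2.2.2 e.1 then h.choose else 0
  refine small_of_surjective (f := f) ?_
  rintro ⟨e, he⟩
  obtain ⟨m, _, A, v, u, hA, h⟩ := id he
  let σ := (Fintype.equivFin m).symm
  have hσ := h.submatrix_equiv σ
  refine ⟨⟨_, A.submatrix σ σ, v ∘ σ, u ∘ σ⟩, ?_⟩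
  have hex : ∃ e : rationalClosure R M,
      IsRationalVia (A.submatrix σ σ) (v ∘ σ) (u ∘ σ) e.1 := ⟨⟨e, he⟩, hσ⟩
  exact (dif_pos hex).trans (Subtype.ext (hex.choose_spec.ext (hA.submatrix_equiv σ σ) hσ))

/-! ### The exchange condition and the embedding into a division ring -/

theorem propositionP {R : Type u} [Ring R] {M : Type v} [AddCommGroup M] [Module Rᵐᵒᵖ M] :
    (∀ N : ℕ, (∀ n : ℕ, 0 < n → n ≤ N → EitherOr R M n) →
      ∀ n : ℕ, n ≤ N → ExchangeAnn R M n) ∧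
    ((∀ n : ℕ, 0 < n → EitherOr R M n) → Nontrivial M → FaithfulSMul Rᵐᵒᵖ M →
      ∃ (D : Type u) (_ : DivisionRing D) (f : R →+* D), Function.Injective f) := by
  refine ⟨fun N hE n hn => exchangeAnn_of_eitherOr fun k hk hkn => hE k hk (hkn.trans hn),
    fun hE _ _ => ?_⟩
  let g : Rᵐᵒᵖ →+* rationalClosure R M :=
    (Module.toAddMonoidEnd Rᵐᵒᵖ M).codRestrict _ toAddMonoidEnd_mem_rationalSet
  have hg : Function.Injective g := fun x y h =>
    eq_of_smul_eq_smul fun s : M => DFunLike.congr_fun (congrArg Subtype.val h) s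
  have : Nontrivial (rationalClosure R M) := by
    obtain ⟨s, hs⟩ := exists_ne (0 : M)
    exact ⟨⟨1, 0, fun h => hs (DFunLike.congr_fun (congrArg Subtype.val h) s)⟩⟩
  let σ := Shrink.ringEquiv.{u} (rationalClosure R M)
  -- The right action represents `Rᵐᵒᵖ`, so `R` itself embeds in the opposite ring.
  let f : R →+* (Shrink.{u} (rationalClosure R M))ᵐᵒᵖ :=
    { toFun := fun x => MulOpposite.op (σ.symm (g (MulOpposite.op x)))
      map_one' := by simp
      map_mul' := fun x y => by simp
      map_zero' := by simp
      map_add' := fun x y => by simp }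
  have hf : Function.Injective f := fun x y h =>
    MulOpposite.op_injective (hg (σ.symm.injective (MulOpposite.op_injective h)))
  have : Nontrivial (Shrink.{u} (rationalClosure R M)) := σ.toEquiv.nontrivial
  let : DivisionRing (Shrink.{u} (rationalClosure R M)) := DivisionRing.ofIsUnitOrEqZero fun x =>
    (isUnit_or_eq_zero_of_eitherOr hE (σ x)).imp (MulEquiv.isUnit_map σ).1
      (map_eq_zero_iff σ σ.injective).1
  exact ⟨_, inferInstance, f, hf⟩
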